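/- **Turing completeness of Core Choreographies (CC).** *Language.* A signature consists of types (with decidable equality) of process names, variables, values, expressions, Boolean expressions, procedure names and annotations, and of functions evaluating expressions to values and Boolean expressions to Booleans in a local state (a map from variables to values). Choreographies are given by $$\eta ::= p\#e \to q.x \;\mid\; p\to q[l],\qquad C ::= \eta@a;C \;\mid\; \mathsf{If}\ p\,??\,b\ \mathsf{Then}\ C_1\ \mathsf{Else}\ C_2 \;\mid\; \mathsf{Call}\ X \;\mid\; \mathsf{RT\_Call}\ X\ \mathit{ps}\ C \;\mid\; \mathsf{End},$$ with $l\in\{\mathsf{left},\mathsf{right}\}$ and $\mathit{ps}$ a list of processes (read as a set). A program $P=(D,C)$ is a map $D$ assigning to every procedure name $X$ a list $\mathrm{Vars}(X)$ of processes and a body $\mathrm{Procs}(X)$, together with a main choreography $C$. It is *well-formed* if: no communication or selection in $C$ or in a body has equal sender and receiver; in each subterm $\mathsf{RT\_Call}\ X\ \mathit{ps}\ C'$ of $C$, $\mathit{ps}$ is non-empty and contained in $\mathrm{Vars}(X)$; the bodies contain no $\mathsf{RT\_Call}$; and every $\mathrm{Vars}(X)$ is non-empty and contains all processes occurring in $\mathrm{Procs}(X)$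 (where the processes occurring in $\mathsf{Call}\ Y$ are those in $\mathrm{Vars}(Y)$). It *uses only the procedures in a list* $\mathit{Xs}$ if $C$ and the bodies of all $X\in\mathit{Xs}$ only call procedures in $\mathit{Xs}$, and $\mathrm{Procs}(X)=\mathsf{End}$, $\mathrm{Vars}(X)\neq\emptyset$ for all $X\notin \mathit{Xs}$. *Semantics.* A state $s$ assigns a value to each process and variable. Transitions $\langle C,s\rangle\to_D\langle C',s'\rangle$, each involving one or two processes, are generated by the following rules. (i) $\langle p\#e\to q.x@a;C,\,s\rangle\to\langle C,\,s[q,x\mapsto v]\rangle$, where $v$ is the value of $e$ in the local state $s(p)$, and $\langle p\to q[l]@a;C,\,s\rangle\to\langle C,s\rangle$; these involve $p,q$. (ii) $\langle\mathsf{If}\ p\,??\,b\ \mathsf{Then}\ C_1\ \mathsf{Else}\ C_2,\,s\rangle\to\langle C_i,s\rangle$, where $i=1$ if $b$ evaluates to true in $s(p)$ and $i=2$ otherwise; this involves $p$. (iii) For $p\in\mathrm{Vars}(X)$: $\mathsf{Call}\ X$ becomes $\mathrm{Procs}(X)$ if $\mathrm{Vars}(X)=\{p\}$, and $\mathsf{RT\_Call}\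 X\ (\mathrm{Vars}(X)\setminus\{p\})\ \mathrm{Procs}(X)$ otherwise. For $p\in \mathit{ps}$: $\mathsf{RT\_Call}\ X\ \mathit{ps}\ C$ becomes $C$ if $\mathit{ps}=\{p\}$, and $\mathsf{RT\_Call}\ X\ (\mathit{ps}\setminus\{p\})\ C$ otherwise. These leave the state unchanged and involve $p$ (they carry the label $(X,p)$). (iv) Out-of-order execution: a transition of $C$ is also one of $\eta@a;C$ (under the prefix), or of $\mathsf{RT\_Call}\ X\ \mathit{ps}\ C$ (under the runtime term), if it involves no process of $\eta$, respectively of $\mathit{ps}$; a transition with the same label and the same resulting state in both $C_1$ and $C_2$ is also one of $\mathsf{If}\ p\,??\,b\ \mathsf{Then}\ C_1\ \mathsf{Else}\ C_2$ if it does not involve $p$. (Labels record the kind of the action and its processes, and the value and variable of a value communication, the label of a selection, and the procedure name of a call.) An execution is a finite sequence of transitions; it *terminates* if it ends with main choreography $\mathsf{End}$. *Minimal signature.* Process names, values and procedure names are natural numbers; there are two variables $x,y$, three expressions, evaluating to the value of $x$, to $0$, and to the successor of the value of $x$, respectively, one Boolean expression, testing whether the values of $x$ and $y$ are equal, and one (trivial)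 annotation. *Implementation.* A program $P$ over the minimal signature *implements* $f:\mathbb N^n\rightharpoonup\mathbb N$ *with input processes* $p_1,\dots,p_n$ *and output process* $q$ if for all $k_1,\dots,k_n\in\mathbb N$ and every state $s$ with $s(p_i)(x)=k_i$ for all $i$: * if $f(k_1,\dots,k_n)$ is defined, then some execution of $P$ from $s$ terminates, and every execution of $P$ from $s$ that terminates does so in a state $s'$ with $s'(q)(x)=f(k_1,\dots,k_n)$; * if $f(k_1,\dots,k_n)$ is undefined, then no execution of $P$ from $s$ terminates. **Theorem.** Let $n\ge 0$, let $f:\mathbb N^n\rightharpoonup\mathbb N$ be a partial recursive function, let $p_1,\dots,p_n$ be distinct processes and let $q$ be a process. Then there is a well-formed CC program over the minimal signature whose main choreography contains no $\mathsf{RT\_Call}$, which uses only the procedures in some finite list, and which implements $f$ with input processes $p_1,\dots,p_n$ and output process $q$. -/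

import Mathlib

namespace CC

/-- Signatures: the parameters of the choreographic language. `eval` and `beval` evaluate an
expression (Boolean expression) in the local state of a process. -/
structure Signature where
  pid : Type
  var : Type
  val : Type
  expr : Type
  bexpr : Type
  recvar : Type
  ann : Type
  [decPid : DecidableEq pid]
  [decVar : DecidableEq var]
  [decVal : DecidableEq val]
  [decExpr : DecidableEq expr]
  [decBexpr : DecidableEq bexpr]
  [decRecvar : DecidableEq recvar]
  [decAnn : DecidableEq ann]
  eval : expr → (var → val) → val
  beval : bexpr → (var → val) → Bool

attribute [instance] Signature.decPid Signature.decVar Signature.decVal Signature.decExpr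
  Signature.decBexpr Signature.decRecvar Signature.decAnn

/-- The two selection labels. -/
inductive Label where
  | left
  | right

/-- Memory states of all processes. (Extensional equality of states is equality.) -/
def State (S : Signature) : Type := S.pid → S.var → S.val

/-- `s.update p x v` is the state `s[[p, x => v]]`. -/
def State.update {S : Signature} (s : State S) (p : S.pid) (x : S.var) (v : S.val) : State S :=
  fun q y => if q = p ∧ y = x then v else s q y

/-- Interactions: `com p e q x` is the value communication `p#e --> q$x`, and
`sel p q l` is the label selection `p --> q[l]`. -/
inductive Eta (S : Signature) where
  | com (p : S.pid) (e : S.expr) (q : S.pid) (x : S.var)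
  | sel (p q : S.pid) (l : Label)

/-- Choreographies. `rtCall X ps C` is the runtime term for a call to `X` that has already evolved
to `C` and that the processes in `ps` have still to join; `done` is the terminated choreography. -/
inductive Choreography (S : Signature) where
  | interaction (eta : Eta S) (a : S.ann) (C : Choreography S)
  | cond (p : S.pid) (b : S.bexpr) (C₁ C₂ : Choreography S)
  | call (X : S.recvar)
  | rtCall (X : S.recvar) (ps : List S.pid) (C : Choreography S)
  | done

/-- Sets of procedure definitions: each procedure name is mapped to the list of processes that the
procedure uses and to its body. -/
abbrev DefSet (S : Signature) : Type := S.recvar → List S.pid × Choreography S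

structure Program (S : Signature) where
  procedures : DefSet S
  main : Choreography S

/-- The list of processes of procedure `X`. -/
def Program.vars {S : Signature} (P : Program S) (X : S.recvar) : List S.pid := (P.procedures X).1

/-- The body of procedure `X`. -/
def Program.procs {S : Signature} (P : Program S) (X : S.recvar) : Choreography S :=
  (P.procedures X).2

/-! Well-formedness -/

section WellFormedness

variable {S : Signature}

/-- The processes of an interaction. -/
def Eta.pn : Eta S → List S.pid
  | .com p _ q _ => [p, q]
  | .sel p q _ => [p, q]

/-- The interaction is not a self-communication. -/
def Eta.noSelf : Eta S → Prop
  | .com p _ q _ => p ≠ q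
  | .sel p q _ => p ≠ q

namespace Choreography

/-- No runtime terms. -/
def initial : Choreography S → Prop
  | interaction _ _ C => C.initial
  | cond _ _ C₁ C₂ => C₁.initial ∧ C₂.initial
  | call _ => True
  | rtCall _ _ _ => False
  | done => True

/-- No self-communications. -/
def noSelfComm : Choreography S → Prop
  | interaction eta _ C => eta.noSelf ∧ C.noSelfComm
  | cond _ _ C₁ C₂ => C₁.noSelfComm ∧ C₂.noSelfComm
  | call _ => True
  | rtCall _ _ C => C.noSelfComm
  | done => True

/-- All runtime terms have nonempty lists of process names. -/
def noEmptyAnn : Choreography S → Prop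
  | interaction _ _ C => C.noEmptyAnn
  | cond _ _ C₁ C₂ => C₁.noEmptyAnn ∧ C₂.noEmptyAnn
  | call _ => True
  | rtCall _ ps C => ps ≠ [] ∧ C.noEmptyAnn
  | done => True

/-- Well-formed choreographies. -/
def WF (C : Choreography S) : Prop := C.noSelfComm ∧ C.noEmptyAnn

/-- Runtime terms for `X` are only annotated with processes among those of `X`. -/
def consistent (V : S.recvar → List S.pid) : Choreography S → Prop
  | interaction _ _ C => C.consistent V
  | cond _ _ C₁ C₂ => C₁.consistent V ∧ C₂.consistent V
  | call _ => True
  | rtCall X ps C => ps ⊆ V X ∧ C.consistent V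
  | done => True

/-- The processes occurring in a choreography, given the processes used in each procedure. -/
def pn (V : S.recvar → List S.pid) : Choreography S → List S.pid
  | interaction eta _ C => eta.pn ++ C.pn V
  | cond p _ C₁ C₂ => p :: (C₁.pn V ++ C₂.pn V)
  | call X => V X
  | rtCall _ ps C => ps ++ C.pn V
  | done => []

/-- The choreography only calls (directly) procedures in `Xs`. -/
def usedProcedures (Xs : List S.recvar) : Choreography S → Prop
  | interaction _ _ C => C.usedProcedures Xs
  | cond _ _ C₁ C₂ => C₁.usedProcedures Xs ∧ C₂.usedProcedures Xs
  | call X => X ∈ Xs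
  | rtCall X _ C => X ∈ Xs ∧ C.usedProcedures Xs
  | done => True

end Choreography

namespace Program

/-- Procedure `X` is well-annotated in `P`. -/
def wellAnn (P : Program S) (X : S.recvar) : Prop :=
  P.vars X ≠ [] ∧ (P.procs X).pn P.vars ⊆ P.vars X

/-- Well-formed programs. -/
def WF (P : Program S) : Prop :=
  P.main.WF ∧ P.main.consistent P.vars ∧
    ∀ X, (P.procs X).noSelfComm ∧ (P.procs X).initial ∧ P.wellAnn X

/-- All procedures of `P` that are used belong to the finite list `Xs`; all others are defined as
the terminated choreography. -/
def usedProcedures (P : Program S) (Xs : List S.recvar) : Prop :=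
  P.main.usedProcedures Xs ∧
    ∀ X, (X ∈ Xs → (P.procs X).usedProcedures Xs) ∧
      (X ∉ Xs → P.procs X = Choreography.done ∧ P.vars X ≠ [])

end Program

end WellFormedness

/-! Semantics -/

/-- Labels of the lower layer of the semantics. -/
inductive RichLabel (S : Signature) where
  | com (p : S.pid) (v : S.val) (q : S.pid) (x : S.var)
  | sel (p q : S.pid) (l : Label)
  | cond (p : S.pid)
  | call (X : S.recvar) (p : S.pid)

/-- Observable labels. -/
inductive TransitionLabel (S : Signature) where
  | com (p : S.pid) (v : S.val) (q : S.pid)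
  | sel (p q : S.pid) (l : Label)
  | tau (p : S.pid)

section Semantics

variable {S : Signature}

def RichLabel.forget : RichLabel S → TransitionLabel S
  | .com p v q _ => .com p v q
  | .sel p q l => .sel p q l
  | .cond p => .tau p
  | .call _ p => .tau p

/-- The processes involved in a transition. -/
def RichLabel.pn : RichLabel S → List S.pid
  | .com p _ q _ => [p, q]
  | .sel p q _ => [p, q]
  | .cond p => [p]
  | .call _ p => [p]

/-- Transitions of choreographies: `CTo D C s t C' s'` is `<<C,s>> --[t,D]--> <<C',s'>>`. Lists of
processes are read as sets: the size of `ps` is `ps.toFinset.card`, and `ps` without `p` is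
`ps.filter (· ≠ p)`. -/
inductive CTo (D : DefSet S) :
    Choreography S → State S → RichLabel S → Choreography S → State S → Prop
  | com (p : S.pid) (e : S.expr) (q : S.pid) (x : S.var) (a : S.ann) (C : Choreography S)
      (s : State S) :
      CTo D (.interaction (.com p e q x) a C) s (.com p (S.eval e (s p)) q x) C
        (s.update q x (S.eval e (s p)))
  | sel (p q : S.pid) (l : Label) (a : S.ann) (C : Choreography S) (s : State S) :
      CTo D (.interaction (.sel p q l) a C) s (.sel p q l) C s
  | then_ (p : S.pid) (b : S.bexpr) (C₁ C₂ : Choreography S) (s : State S) :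
      S.beval b (s p) = true → CTo D (.cond p b C₁ C₂) s (.cond p) C₁ s
  | else_ (p : S.pid) (b : S.bexpr) (C₁ C₂ : Choreography S) (s : State S) :
      S.beval b (s p) = false → CTo D (.cond p b C₁ C₂) s (.cond p) C₂ s
  | delayEta (eta : Eta S) (a : S.ann) (C C' : Choreography S) (t : RichLabel S) (s s' : State S) :
      List.Disjoint eta.pn t.pn → CTo D C s t C' s' →
      CTo D (.interaction eta a C) s t (.interaction eta a C') s'
  | delayCond (p : S.pid) (b : S.bexpr) (C₁ C₂ C₁' C₂' : Choreography S) (t : RichLabel S)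
      (s s' : State S) :
      p ∉ t.pn → CTo D C₁ s t C₁' s' → CTo D C₂ s t C₂' s' →
      CTo D (.cond p b C₁ C₂) s t (.cond p b C₁' C₂') s'
  | delayCall (X : S.recvar) (ps : List S.pid) (C C' : Choreography S) (t : RichLabel S)
      (s s' : State S) :
      List.Disjoint ps t.pn → CTo D C s t C' s' →
      CTo D (.rtCall X ps C) s t (.rtCall X ps C') s'
  | callLocal (X : S.recvar) (p : S.pid) (s : State S) :
      (D X).1.toFinset.card = 1 → p ∈ (D X).1 →
      CTo D (.call X) s (.call X p) (D X).2 s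
  | callStart (X : S.recvar) (p : S.pid) (s : State S) :
      1 < (D X).1.toFinset.card → p ∈ (D X).1 →
      CTo D (.call X) s (.call X p) (.rtCall X ((D X).1.filter (· ≠ p)) (D X).2) s
  | callEnter (X : S.recvar) (ps : List S.pid) (p : S.pid) (C : Choreography S) (s : State S) :
      1 < ps.toFinset.card → p ∈ ps →
      CTo D (.rtCall X ps C) s (.call X p) (.rtCall X (ps.filter (· ≠ p)) C) s
  | callFinish (X : S.recvar) (ps : List S.pid) (p : S.pid) (C : Choreography S) (s : State S) :
      ps.toFinset.card = 1 → p ∈ ps →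
      CTo D (.rtCall X ps C) s (.call X p) C s

/-- Configurations: a program together with a state. -/
abbrev Configuration (S : Signature) : Type := Program S × State S

/-- One-step transitions of configurations. -/
inductive Step : Configuration S → TransitionLabel S → Configuration S → Prop
  | base (D : DefSet S) (C C' : Choreography S) (s s' : State S) (t : RichLabel S) :
      CTo D C s t C' s' → Step (⟨D, C⟩, s) t.forget (⟨D, C'⟩, s')

/-- Multi-step transitions of configurations. -/
inductive Steps : Configuration S → List (TransitionLabel S) → Configuration S → Prop
  | refl (c : Configuration S) : Steps c [] c
  | step (c₁ c₂ c₃ : Configuration S) (t : TransitionLabel S) (l : List (TransitionLabel S)) :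
      Step c₁ t c₂ → Steps c₂ l c₃ → Steps c₁ (t :: l) c₃

end Semantics

/-! The signature with minimal computational capabilities -/

/-- Each process has two variables. -/
inductive MinVar where
  | x
  | y
  deriving DecidableEq

/-- The value of the variable `x`, the constant zero, and the successor of the value of `x`. -/
inductive MinExpr where
  | this
  | zero
  | succ
  deriving DecidableEq

/-- The test whether the values of the variables `x` and `y` are equal. -/
inductive MinBExpr where
  | compare
  deriving DecidableEq

def MinExpr.eval : MinExpr → (MinVar → ℕ) → ℕ
  | this, m => m .x
  | zero, _ => 0
  | succ, m => m .x + 1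

def MinBExpr.eval : MinBExpr → (MinVar → ℕ) → Bool
  | compare, m => decide (m .x = m .y)

/-- The signature in which process names, procedure names and values are natural numbers and in
which processes can only compute successors and decide equality. Annotations are trivial. -/
abbrev minSig : Signature where
  pid := ℕ
  var := MinVar
  val := ℕ
  expr := MinExpr
  bexpr := MinBExpr
  recvar := ℕ
  ann := Unit
  eval := MinExpr.eval
  beval := MinBExpr.eval

/-- `P` implements the partial function `f` with input processes `ps` and output process `q`: from
every state in which the inputs are stored at (the variable `x` of) the processes `ps`,
* if `f` is defined on the inputs, then `P` can be executed until it terminates, and every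
  execution that terminates leaves the value of `f` at (the variable `x` of) `q`;
* if `f` is not defined on the inputs, then no execution of `P` terminates. -/
def Implements {n : ℕ} (P : Program minSig) (f : List.Vector ℕ n →. ℕ) (ps : Fin n → ℕ) (q : ℕ) :
    Prop :=
  ∀ (v : List.Vector ℕ n) (s : State minSig), (∀ i, s (ps i) .x = v.get i) →
    (∀ r ∈ f v,
      (∃ ts c, Steps (P, s) ts c ∧ c.1.main = .done) ∧
        ∀ ts c, Steps (P, s) ts c → c.1.main = .done → c.2 q .x = r) ∧
    (¬ (f v).Dom → ∀ ts c, Steps (P, s) ts c → c.1.main ≠ .done)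

end CC

/-! Out-of-order execution is harmless: a transition involves no process of whatever it overtakes,
so the two commute. Let `Big` be sequential execution, which follows program order and ignores who
has still to join a call. Termination under `Big` with a given result is preserved when any
transition is prepended (`CTo.big`), so every terminating execution ends in the state that
sequential execution reaches (`Steps.big`). Conversely, a sequential execution is itself an
execution (`Big.steps`). Only sequential behaviour matters from then on.

Sequential programs are written in a loop language `Cmd` and compiled with continuations: a loop
becomes a procedure that tests its guard and then either proceeds to the continuation or runs the
loop body and calls itself. Compilation preserves and reflects results (`Exec.big`, `exec_of_big`).

It remains to program partial recursive functions in `Cmd`, by induction on `Nat.Partrec'`. The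
induction hypothesis `Computable` allows arbitrary input and output processes and any bound `m`
above them: below `m` only the output changes, and from `m` on lies scratch space with arbitrary
contents. This makes programs composable. `Spec` constrains all final states but promises
termination only on the domain; divergence elsewhere follows because a final state would exhibit a
value of the function. -/

namespace CC

/-! ### Sequential execution and its agreement with out-of-order execution. -/

section BigStep

variable {S : Signature}

/-- The effect of an interaction on the memory. -/
def Eta.effect : Eta S → State S → State S
  | .com p e q x, s => s.update q x (S.eval e (s p))
  | .sel _ _ _, s => s

/-- The effect of a transition on the memory. -/
def RichLabel.effect : RichLabel S → State S → State S
  | .com _ v q x, s => s.update q x v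
  | .sel _ _ _, s => s
  | .cond _, s => s
  | .call _ _, s => s

theorem State.update_of_ne (s : State S) {p q : S.pid} (x : S.var) (v : S.val) (h : q ≠ p) :
    s.update p x v q = s q := by
  funext y
  simp [State.update, h]

theorem State.update_comm (s : State S) {p q : S.pid} (x y : S.var) (v w : S.val) (h : p ≠ q) :
    (s.update p x v).update q y w = (s.update q y w).update p x v := by
  funext r z
  simp only [State.update]
  grind

theorem RichLabel.effect_of_notMem (t : RichLabel S) (s : State S) {p : S.pid} (h : p ∉ t.pn) :
    t.effect s p = s p := by
  cases t with
  | com p' v q x =>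
    simp only [RichLabel.pn, List.mem_cons, List.not_mem_nil, or_false, not_or] at h
    exact State.update_of_ne _ _ _ h.2
  | _ => rfl

theorem Eta.effect_of_notMem (eta : Eta S) (s : State S) {p : S.pid} (h : p ∉ eta.pn) :
    eta.effect s p = s p := by
  cases eta with
  | com p' e q x =>
    simp only [Eta.pn, List.mem_cons, List.not_mem_nil, or_false, not_or] at h
    exact State.update_of_ne _ _ _ h.2
  | _ => rfl

/-- The transition does not touch the sender of `eta`, so the value sent is the same before and
after it; the receivers differ, so the two updates commute. -/
theorem Eta.effect_comm (eta : Eta S) (t : RichLabel S) (s : State S)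
    (h : List.Disjoint eta.pn t.pn) : eta.effect (t.effect s) = t.effect (eta.effect s) := by
  cases eta with
  | sel => rfl
  | com p e q x =>
    have hp : t.effect s p = s p := t.effect_of_notMem s fun hm => h (by simp [Eta.pn]) hm
    simp only [Eta.effect, hp]
    cases t with
    | com p' v q' y =>
      refine State.update_comm _ _ _ _ _ ?_
      rintro rfl
      exact h (a := q') (by simp [Eta.pn]) (by simp [RichLabel.pn])
    | _ => rfl

/-- Sequential execution: `Big D n C s r` means that executing `C` from `s` in program order, with
`n` procedure calls, terminates in the state `r`. -/
inductive Big (D : DefSet S) : ℕ → Choreography S → State S → State S → Prop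
  | done (s : State S) : Big D 0 .done s s
  | interaction {n : ℕ} {eta : Eta S} {a : S.ann} {C : Choreography S} {s r : State S} :
      Big D n C (eta.effect s) r → Big D n (.interaction eta a C) s r
  | cond {n : ℕ} {p : S.pid} {b : S.bexpr} {C₁ C₂ : Choreography S} {s r : State S} :
      Big D n (if S.beval b (s p) then C₁ else C₂) s r → Big D n (.cond p b C₁ C₂) s r
  | call {n : ℕ} {X : S.recvar} {s r : State S} :
      Big D n (D X).2 s r → Big D (n + 1) (.call X) s r
  | rtCall {n : ℕ} {X : S.recvar} {ps : List S.pid} {C : Choreography S} {s r : State S} :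
      Big D n C s r → Big D n (.rtCall X ps C) s r

theorem CTo.effect_eq {D : DefSet S} {C C' : Choreography S} {s s' : State S} {t : RichLabel S}
    (h : CTo D C s t C' s') : s' = t.effect s := by
  induction h with
  | _ => first | rfl | assumption

/-- Sequential termination is reflected by out-of-order transitions. -/
theorem CTo.big {D : DefSet S} {C C' : Choreography S} {s s' : State S} {t : RichLabel S}
    (h : CTo D C s t C' s') (u : State S) (hu : ∀ p ∈ t.pn, u p = s p) (n : ℕ) (r : State S)
    (hb : Big D n C' (t.effect u) r) : ∃ m, Big D m C u r := by
  -- `u` has to vary: below a prefix `eta` the induction hypothesis is needed at `eta.effect u`,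
  -- which still agrees with `s` on the processes of `t` but perhaps nowhere else.
  induction h generalizing u n with
  | com p e q x a C s =>
    refine ⟨n, .interaction ?_⟩
    simpa [Eta.effect, RichLabel.effect, hu p (by simp [RichLabel.pn])] using hb
  | sel => exact ⟨n, .interaction hb⟩
  | then_ p b C₁ C₂ s h =>
    refine ⟨n, .cond ?_⟩
    rw [hu p (by simp [RichLabel.pn]), h]
    exact hb
  | else_ p b C₁ C₂ s h =>
    refine ⟨n, .cond ?_⟩
    rw [hu p (by simp [RichLabel.pn]), h]
    exact hb
  | delayEta eta a C C' t s s' hd h ih =>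
    cases hb with
    | interaction hb =>
      rw [eta.effect_comm t u hd] at hb
      obtain ⟨m, hm⟩ := ih (eta.effect u)
        (fun p hp => (eta.effect_of_notMem u fun h' => hd h' hp).trans (hu p hp)) n hb
      exact ⟨m, .interaction hm⟩
  | delayCond p b C₁ C₂ C₁' C₂' t s s' hp h₁ h₂ ih₁ ih₂ =>
    cases hb with
    | cond hb =>
      -- Since `t` does not involve `p`, the guard has the same value before and after `t`, and only
      -- the branch it selects matters.
      rw [t.effect_of_notMem u hp] at hb
      by_cases hc : S.beval b (u p) = true
      · rw [if_pos hc] at hb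
        obtain ⟨m, hm⟩ := ih₁ u hu n hb
        exact ⟨m, .cond (by rwa [if_pos hc])⟩
      · rw [if_neg hc] at hb
        obtain ⟨m, hm⟩ := ih₂ u hu n hb
        exact ⟨m, .cond (by rwa [if_neg hc])⟩
  | delayCall X ps C C' t s s' hd h ih =>
    cases hb with
    | rtCall hb =>
      obtain ⟨m, hm⟩ := ih u hu n hb
      exact ⟨m, .rtCall hm⟩
  | callLocal => exact ⟨n + 1, .call hb⟩
  | callStart =>
    cases hb with
    | rtCall hb => exact ⟨n + 1, .call hb⟩
  | callEnter =>
    cases hb with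
    | rtCall hb => exact ⟨n, .rtCall hb⟩
  | callFinish => exact ⟨n, .rtCall hb⟩

/-- Every terminating execution computes the result of sequential execution. -/
theorem Steps.big {c c' : Configuration S} {ts : List (TransitionLabel S)} (h : Steps c ts c')
    (hc : c'.1.main = .done) : ∃ n, Big c.1.procedures n c.1.main c.2 c'.2 := by
  induction h with
  | refl c => exact ⟨0, by rw [hc]; exact .done _⟩
  | step c₁ c₂ c₃ t l h₁ h₂ ih =>
    obtain ⟨n, hn⟩ := ih hc
    cases h₁ with
    | base D C C' s s' t h =>
      have hs := h.effect_eq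
      subst hs
      exact h.big s (fun _ _ => rfl) n _ hn

/-- The processes in `ps` can all join, one after the other, before `C` moves. Joining removes every
duplicate of a process at once, so `k` only bounds the length of the list. -/
theorem Steps.rtCall {D : DefSet S} (X : S.recvar) (C : Choreography S) (s : State S) (k : ℕ)
    (ps : List S.pid) (hk : ps.length ≤ k) (hps : ps ≠ []) :
    ∀ {l c}, Steps (⟨D, C⟩, s) l c → ∃ l', Steps (⟨D, .rtCall X ps C⟩, s) l' c := by
  intro l c h
  induction k generalizing ps with
  | zero => exact absurd (List.length_eq_zero_iff.1 (Nat.le_zero.1 hk)) hps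
  | succ k ih =>
    obtain ⟨p, hp⟩ := List.exists_mem_of_ne_nil ps hps
    have hpos : 0 < ps.toFinset.card := Finset.card_pos.2 ⟨p, by simpa using hp⟩
    rcases Nat.lt_or_ge 1 ps.toFinset.card with h1 | h1
    · have hlt : (ps.filter (· ≠ p)).length < ps.length :=
        List.length_filter_lt_length_iff_exists.2 ⟨p, hp, by simp⟩
      have hne : ps.filter (· ≠ p) ≠ [] := by
        obtain ⟨a, ha, hap⟩ := Finset.exists_mem_ne h1 p
        exact List.ne_nil_of_mem (a := a) (by simpa using ⟨by simpa using ha, hap⟩)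
      obtain ⟨l', hl'⟩ := ih _ (by omega) hne
      exact ⟨_, .step _ _ _ _ _ (.base D _ _ s s _ (.callEnter X ps p C s h1 hp)) hl'⟩
    · exact ⟨_, .step _ _ _ _ _ (.base D _ _ s s _ (.callFinish X ps p C s (by omega) hp)) h⟩

theorem Steps.call {D : DefSet S} {X : S.recvar} {s : State S} (hX : (D X).1 ≠ [])
    {l c} (h : Steps (⟨D, (D X).2⟩, s) l c) : ∃ l', Steps (⟨D, .call X⟩, s) l' c := by
  obtain ⟨p, hp⟩ := List.exists_mem_of_ne_nil _ hX
  have hpos : 0 < (D X).1.toFinset.card := Finset.card_pos.2 ⟨p, by simpa using hp⟩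
  rcases Nat.lt_or_ge 1 (D X).1.toFinset.card with h1 | h1
  · have hne : (D X).1.filter (· ≠ p) ≠ [] := by
      obtain ⟨a, ha, hap⟩ := Finset.exists_mem_ne h1 p
      exact List.ne_nil_of_mem (a := a) (by simpa using ⟨by simpa using ha, hap⟩)
    obtain ⟨l', hl'⟩ := Steps.rtCall X _ s _ _ le_rfl hne h
    exact ⟨_, .step _ _ _ _ _ (.base D _ _ s s _ (.callStart X p s h1 hp)) hl'⟩
  · exact ⟨_, .step _ _ _ _ _ (.base D _ _ s s _ (.callLocal X p s (by omega) hp)) h⟩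

theorem Choreography.initial.noEmptyAnn {C : Choreography S} (h : C.initial) : C.noEmptyAnn := by
  induction C with
  | interaction eta a C ih => exact ih h
  | cond p b C₁ C₂ ih₁ ih₂ => exact ⟨ih₁ h.1, ih₂ h.2⟩
  | call => trivial
  | rtCall => exact h.elim
  | done => trivial

theorem Choreography.initial.consistent {C : Choreography S} (h : C.initial)
    (V : S.recvar → List S.pid) : C.consistent V := by
  induction C with
  | interaction eta a C ih => exact ih h
  | cond p b C₁ C₂ ih₁ ih₂ => exact ⟨ih₁ h.1, ih₂ h.2⟩
  | call => trivial
  | rtCall => exact h.elim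
  | done => trivial

/-- Sequential execution of choreographies without runtime terms is an execution. -/
theorem Big.steps {D : DefSet S} (hD : ∀ X, (D X).1 ≠ [] ∧ (D X).2.initial) {n : ℕ}
    {C : Choreography S} {s r : State S} (h : Big D n C s r) (hC : C.initial) :
    ∃ l, Steps (⟨D, C⟩, s) l (⟨D, .done⟩, r) := by
  induction h with
  | done s => exact ⟨_, .refl _⟩
  | @interaction n eta a C s r _ ih =>
    obtain ⟨l, hl⟩ := ih hC
    cases eta with
    | com p e q x => exact ⟨_, .step _ _ _ _ _ (.base D _ _ _ _ _ (.com p e q x a C s)) hl⟩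
    | sel p q b => exact ⟨_, .step _ _ _ _ _ (.base D _ _ _ _ _ (.sel p q b a C s)) hl⟩
  | @cond n p b C₁ C₂ s r _ ih =>
    by_cases hb : S.beval b (s p) = true
    · obtain ⟨l, hl⟩ := ih (by rw [if_pos hb]; exact hC.1)
      rw [if_pos hb] at hl
      exact ⟨_, .step _ _ _ _ _ (.base D _ _ _ _ _ (.then_ p b C₁ C₂ s hb)) hl⟩
    · obtain ⟨l, hl⟩ := ih (by rw [if_neg hb]; exact hC.2)
      rw [if_neg hb] at hl
      exact ⟨_, .step _ _ _ _ _ (.base D _ _ _ _ _ (.else_ p b C₁ C₂ s (by simpa using hb))) hl⟩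
  | @call n X s r _ ih =>
    obtain ⟨l, hl⟩ := ih (hD X).2
    exact Steps.call (hD X).1 hl
  | rtCall => exact hC.elim

end BigStep

/-! ### A loop language and its compilation to choreographies. -/

/-- Structured programs acting on the memory of the processes. `loop p c` repeats `c` until the
two variables of `p` have equal values. -/
inductive Cmd where
  | skip
  | com (p : ℕ) (e : MinExpr) (q : ℕ) (z : MinVar) (h : p ≠ q)
  | seq (c₁ c₂ : Cmd)
  | loop (p : ℕ) (c : Cmd)

namespace Cmd

/-- Execution of structured programs. -/
inductive Exec : Cmd → State minSig → State minSig → Prop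
  | skip (s : State minSig) : Exec .skip s s
  | com {p : ℕ} {e : MinExpr} {q : ℕ} {z : MinVar} {h : p ≠ q} (s : State minSig) :
      Exec (.com p e q z h) s (s.update q z (e.eval (s p)))
  | seq {c₁ c₂ : Cmd} {s s' s'' : State minSig} :
      Exec c₁ s s' → Exec c₂ s' s'' → Exec (.seq c₁ c₂) s s''
  | loopExit {p : ℕ} {c : Cmd} {s : State minSig} : s p .x = s p .y → Exec (.loop p c) s s
  | loopStep {p : ℕ} {c : Cmd} {s s' s'' : State minSig} :
      s p .x ≠ s p .y → Exec c s s' → Exec (.loop p c) s' s'' → Exec (.loop p c) s s''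

/-- The number of procedures needed by a structured program. -/
def size : Cmd → ℕ
  | skip => 0
  | com _ _ _ _ _ => 0
  | seq c₁ c₂ => c₁.size + c₂.size
  | loop _ c => c.size + 1

/-- A strict upper bound of the processes of a structured program. -/
def bound : Cmd → ℕ
  | skip => 0
  | com p _ q _ _ => max (p + 1) (q + 1)
  | seq c₁ c₂ => max c₁.bound c₂.bound
  | loop p c => max (p + 1) c.bound

/-- The choreography for a structured program followed by `K`. Procedures are named from `n` on. -/
def chor : Cmd → ℕ → Choreography minSig → Choreography minSig
  | skip, _, K => K
  | com p e q z _, _, K => .interaction (.com p e q z) () K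
  | seq c₁ c₂, n, K => c₁.chor n (c₂.chor (n + c₁.size) K)
  -- The continuation is not lost: it is the exit branch of procedure `n`.
  | loop _ _, n, _ => .call n

/-- The bodies of the procedures used by `c.chor n K`. -/
def bodies : Cmd → ℕ → Choreography minSig → List (Choreography minSig)
  | skip, _, _ => []
  | com _ _ _ _ _, _, _ => []
  | seq c₁ c₂, n, K => c₁.bodies n (c₂.chor (n + c₁.size) K) ++ c₂.bodies (n + c₁.size) K
  -- The loop body continues with a call to `n`, which closes the loop.
  | loop p c, n, K => .cond p .compare K (c.chor (n + 1) (.call n)) :: c.bodies (n + 1) (.call n)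

theorem length_bodies (c : Cmd) (n : ℕ) (K : Choreography minSig) :
    (c.bodies n K).length = c.size := by
  induction c generalizing n K <;> simp_all [bodies, size]

/-- `D` contains the procedures used by `c.chor n K`. -/
def Defined (D : DefSet minSig) (c : Cmd) (n : ℕ) (K : Choreography minSig) : Prop :=
  ∀ i (h : i < (c.bodies n K).length), (D (n + i)).2 = (c.bodies n K)[i]

theorem Defined.left {D : DefSet minSig} {c₁ c₂ : Cmd} {n : ℕ} {K : Choreography minSig}
    (h : Defined D (c₁.seq c₂) n K) : Defined D c₁ n (c₂.chor (n + c₁.size) K) := by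
  intro i hi
  rw [h i (by simp only [bodies, List.length_append]; omega)]
  exact List.getElem_append_left hi

theorem Defined.right {D : DefSet minSig} {c₁ c₂ : Cmd} {n : ℕ} {K : Choreography minSig}
    (h : Defined D (c₁.seq c₂) n K) : Defined D c₂ (n + c₁.size) K := by
  intro i hi
  rw [Nat.add_assoc, h (c₁.size + i) (by
    simp only [bodies, List.length_append, length_bodies] at hi ⊢; omega)]
  simp only [bodies]
  rw [List.getElem_append_right (by simp [length_bodies])]
  simp [length_bodies]

theorem Defined.head {D : DefSet minSig} {p : ℕ} {c : Cmd} {n : ℕ} {K : Choreography minSig}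
    (h : Defined D (c.loop p) n K) :
    (D n).2 = .cond p .compare K (c.chor (n + 1) (.call n)) :=
  h 0 (by simp [bodies])

theorem Defined.body {D : DefSet minSig} {p : ℕ} {c : Cmd} {n : ℕ} {K : Choreography minSig}
    (h : Defined D (c.loop p) n K) : Defined D c (n + 1) (.call n) := by
  intro i hi
  rw [Nat.add_assoc, Nat.add_comm 1 i, h (i + 1) (by simpa [bodies] using hi)]
  simp [bodies]

theorem beval_compare (m : MinVar → ℕ) :
    minSig.beval MinBExpr.compare m = true ↔ m .x = m .y :=
  decide_eq_true_iff

/-- The translation into choreographies is complete. -/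
theorem Exec.big {D : DefSet minSig} {c : Cmd} {s s' : State minSig} (h : Exec c s s') :
    ∀ {n : ℕ} {K : Choreography minSig} {r : State minSig} {k : ℕ}, Defined D c n K →
      Big D k K s' r → ∃ m, Big D m (c.chor n K) s r := by
  induction h with
  | skip s => exact fun _ hb => ⟨_, hb⟩
  | com s => exact fun _ hb => ⟨_, .interaction hb⟩
  | seq _ _ ih₁ ih₂ =>
    intro n K r k hD hb
    obtain ⟨m, hm⟩ := ih₂ hD.right hb
    exact ih₁ hD.left hm
  | loopExit h =>
    intro n K r k hD hb
    refine ⟨k + 1, .call ?_⟩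
    rw [hD.head]
    refine .cond ?_
    rwa [if_pos ((beval_compare _).2 h)]
  | loopStep h _ _ ih₁ ih₂ =>
    intro n K r k hD hb
    obtain ⟨m, hm⟩ := ih₂ hD hb
    obtain ⟨m', hm'⟩ := ih₁ hD.body hm
    refine ⟨m' + 1, .call ?_⟩
    rw [hD.head]
    refine .cond ?_
    rwa [if_neg (mt (beval_compare _).1 h)]

/-- The translation into choreographies is sound. -/
theorem exec_of_big {D : DefSet minSig} (c : Cmd) :
    ∀ {n : ℕ} {K : Choreography minSig} {s r : State minSig} {k : ℕ}, Defined D c n K →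
      Big D k (c.chor n K) s r → ∃ s' m, m ≤ k ∧ Exec c s s' ∧ Big D m K s' r := by
  induction c with
  | skip => exact fun _ hb => ⟨_, _, le_rfl, .skip _, hb⟩
  | com p e q z h =>
    intro n K s r k hD hb
    cases hb with
    | interaction hb => exact ⟨_, _, le_rfl, .com _, hb⟩
  | seq c₁ c₂ ih₁ ih₂ =>
    intro n K s r k hD hb
    obtain ⟨s₁, m₁, h₁, he₁, hb₁⟩ := ih₁ hD.left hb
    obtain ⟨s₂, m₂, h₂, he₂, hb₂⟩ := ih₂ hD.right hb₁
    exact ⟨s₂, m₂, h₂.trans h₁, .seq he₁ he₂, hb₂⟩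
  | loop p c ih =>
    intro n K s r k hD
    -- Entering the loop procedure consumes one call, and the loop body hands over to `call n` with
    -- no more calls than remained. Counting calls in `Big` serves this induction.
    induction k using Nat.strong_induction_on generalizing s with
    | _ k ihk =>
      intro hb
      cases hb with
      | @call k _ _ _ hb =>
        rw [hD.head] at hb
        cases hb with
        | cond hb =>
          by_cases hc : s p .x = s p .y
          · rw [if_pos ((beval_compare _).2 hc)] at hb
            exact ⟨s, k, Nat.le_succ k, .loopExit hc, hb⟩
          · rw [if_neg (mt (beval_compare _).1 hc)] at hb
            obtain ⟨s₁, m₁, h₁, he₁, hb₁⟩ := ih hD.body hb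
            obtain ⟨s₂, m₂, h₂, he₂, hb₂⟩ := ihk m₁ (Nat.lt_succ_of_le h₁) hb₁
            exact ⟨s₂, m₂, by omega, .loopStep hc he₁ he₂, hb₂⟩

/-! ### Well-formedness of compiled programs. -/

/-- The static properties of choreographies that make up well-formedness, for programs with
processes below `N` and procedures below `M`. -/
structure Admissible (N M : ℕ) (C : Choreography minSig) : Prop where
  noSelfComm : C.noSelfComm
  initial : C.initial
  pn : C.pn (fun _ => List.range N) ⊆ List.range N
  usedProcedures : C.usedProcedures (List.range M)

theorem Admissible.done (N M : ℕ) : Admissible N M .done :=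
  ⟨trivial, trivial, by simp [Choreography.pn], trivial⟩

theorem Admissible.call {N M X : ℕ} (h : X < M) : Admissible N M (.call X) :=
  ⟨trivial, trivial, by simp [Choreography.pn], List.mem_range.2 h⟩

theorem admissible_chor {N M : ℕ} (c : Cmd) :
    ∀ {n : ℕ} {K : Choreography minSig}, c.bound ≤ N → n + c.size ≤ M → Admissible N M K →
      Admissible N M (c.chor n K) ∧ ∀ C ∈ c.bodies n K, Admissible N M C := by
  induction c with
  | skip => exact fun _ _ hK => ⟨hK, by simp [bodies]⟩
  | com p e q z h =>
    intro n K hN _ hK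
    simp only [bound, max_le_iff] at hN
    refine ⟨⟨⟨h, hK.noSelfComm⟩, hK.initial, ?_, hK.usedProcedures⟩, by simp [bodies]⟩
    simp only [chor, Choreography.pn, Eta.pn, List.append_subset, List.cons_subset,
      List.mem_range, List.nil_subset, and_true]
    exact ⟨⟨by omega, by omega⟩, hK.pn⟩
  | seq c₁ c₂ ih₁ ih₂ =>
    intro n K hN hM hK
    simp only [bound, max_le_iff] at hN
    simp only [size] at hM
    -- The translation of `c₂` is the continuation of `c₁`, so its admissibility comes first.
    have h₂ := ih₂ (n := n + c₁.size) hN.2 (by omega) hK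
    have h₁ := ih₁ (n := n) hN.1 (by omega) h₂.1
    refine ⟨h₁.1, fun C hC => ?_⟩
    rcases List.mem_append.1 hC with hC | hC
    exacts [h₁.2 C hC, h₂.2 C hC]
  | loop p c ih =>
    intro n K hN hM hK
    simp only [bound, max_le_iff] at hN
    simp only [size] at hM
    have hn : Admissible N M (.call n) := .call (by omega)
    have h := ih (n := n + 1) hN.2 (by omega) hn
    refine ⟨hn, fun C hC => ?_⟩
    rcases List.mem_cons.1 hC with rfl | hC
    · refine ⟨⟨hK.noSelfComm, h.1.noSelfComm⟩, ⟨hK.initial, h.1.initial⟩, ?_,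
        ⟨hK.usedProcedures, h.1.usedProcedures⟩⟩
      simp only [Choreography.pn, List.append_subset, List.cons_subset, List.mem_range]
      exact ⟨by omega, hK.pn, h.1.pn⟩
    · exact h.2 C hC

/-- The program for a structured program. -/
def toProgram (c : Cmd) : Program minSig where
  -- All procedures, used or not, declare the same processes, so annotations are trivially closed
  -- under calls. The `+ 1` keeps the list non-empty when the bound is 0, and names outside the
  -- compiled bodies default to `done`.
  procedures X := (List.range (c.bound + 1), (c.bodies 0 .done).getD X .done)
  main := c.chor 0 .done

theorem admissible_main (c : Cmd) : Admissible (c.bound + 1) c.size c.toProgram.main :=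
  (c.admissible_chor (Nat.le_succ _) (Nat.zero_add _).le (.done _ _)).1

theorem admissible_procs (c : Cmd) (X : ℕ) :
    Admissible (c.bound + 1) c.size (c.toProgram.procs X) := by
  change Admissible _ _ ((c.bodies 0 .done).getD X .done)
  rcases Nat.lt_or_ge X (c.bodies 0 .done).length with h | h
  · rw [List.getD_eq_getElem _ _ h]
    exact (c.admissible_chor (Nat.le_succ _) (Nat.zero_add _).le (.done _ _)).2 _
      (List.getElem_mem h)
  · rw [List.getD_eq_default _ _ h]
    exact .done _ _

theorem range_bound_ne_nil (c : Cmd) : List.range (c.bound + 1) ≠ [] := by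
  simp

theorem wf_toProgram (c : Cmd) : c.toProgram.WF :=
  ⟨⟨c.admissible_main.noSelfComm, c.admissible_main.initial.noEmptyAnn⟩,
    c.admissible_main.initial.consistent _, fun X =>
    ⟨(c.admissible_procs X).noSelfComm, (c.admissible_procs X).initial,
      c.range_bound_ne_nil, (c.admissible_procs X).pn⟩⟩

theorem usedProcedures_toProgram (c : Cmd) :
    c.toProgram.usedProcedures (List.range c.size) := by
  refine ⟨c.admissible_main.usedProcedures, fun X =>
    ⟨fun _ => (c.admissible_procs X).usedProcedures, fun h => ⟨?_, c.range_bound_ne_nil⟩⟩⟩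
  refine List.getD_eq_default _ _ ?_
  rw [length_bodies]
  simpa using h

theorem defined_toProgram (c : Cmd) : Defined c.toProgram.procedures c 0 .done := by
  intro i hi
  rw [Nat.zero_add]
  exact List.getD_eq_getElem _ _ hi

theorem exec_of_steps {c : Cmd} {s : State minSig} {ts : List (TransitionLabel minSig)}
    {d : Configuration minSig} (h : Steps (c.toProgram, s) ts d) (hd : d.1.main = .done) :
    Exec c s d.2 := by
  obtain ⟨n, hn⟩ := h.big hd
  obtain ⟨s', m, -, he, hb⟩ := exec_of_big c c.defined_toProgram hn
  cases hb
  exact he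

theorem Exec.steps {c : Cmd} {s r : State minSig} (h : Exec c s r) :
    ∃ ts d, Steps (c.toProgram, s) ts d ∧ d.1.main = .done := by
  obtain ⟨m, hm⟩ := h.big c.defined_toProgram (.done r)
  have hD : ∀ X : ℕ, (c.toProgram.procedures X).1 ≠ [] ∧ (c.toProgram.procedures X).2.initial :=
    fun X => ⟨c.range_bound_ne_nil, (c.admissible_procs X).initial⟩
  obtain ⟨ts, hts⟩ := hm.steps hD c.admissible_main.initial
  exact ⟨ts, _, hts, rfl⟩

/-! ### Correctness rules for structured programs. -/

/-- Executions of `c` from `s` end in states satisfying `Q`, and exist if `T` holds. -/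
def Spec (c : Cmd) (s : State minSig) (Q : State minSig → Prop) (T : Prop) : Prop :=
  (∀ s', Exec c s s' → Q s') ∧ (T → ∃ s', Exec c s s')

theorem Spec.mono {c : Cmd} {s : State minSig} {Q Q' : State minSig → Prop} {T T' : Prop}
    (h : Spec c s Q T) (hQ : ∀ s', Q s' → Q' s') (hT : T' → T) : Spec c s Q' T' :=
  ⟨fun s' hs => hQ s' (h.1 s' hs), fun t => h.2 (hT t)⟩

theorem Spec.seq {c₁ c₂ : Cmd} {s : State minSig} {Q₁ Q₂ : State minSig → Prop} {T : Prop}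
    (h₁ : Spec c₁ s Q₁ T) (h₂ : ∀ s₁, Q₁ s₁ → Spec c₂ s₁ Q₂ T) : Spec (c₁.seq c₂) s Q₂ T := by
  constructor
  · rintro s' (_ | _ | ⟨he₁, he₂⟩)
    exact (h₂ _ (h₁.1 _ he₁)).1 _ he₂
  · intro t
    obtain ⟨s₁, he₁⟩ := h₁.2 t
    obtain ⟨s₂, he₂⟩ := (h₂ s₁ (h₁.1 _ he₁)).2 t
    exact ⟨s₂, .seq he₁ he₂⟩

theorem spec_skip {s : State minSig} {Q : State minSig → Prop} {T : Prop} (h : Q s) :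
    Spec skip s Q T := by
  refine ⟨?_, fun _ => ⟨_, .skip s⟩⟩
  rintro s' ⟨⟩
  exact h

theorem spec_com {p : ℕ} {e : MinExpr} {q : ℕ} {z : MinVar} (hpq : p ≠ q) {s : State minSig}
    {Q : State minSig → Prop} {T : Prop} (h : Q (s.update q z (e.eval (s p)))) :
    Spec (com p e q z hpq) s Q T := by
  refine ⟨?_, fun _ => ⟨_, .com s⟩⟩
  rintro s' (_ | _)
  exact h

/-- The loop rule, for an invariant `I k` that holds after `k` iterations. -/
theorem spec_loop {p : ℕ} {c : Cmd} {I : ℕ → State minSig → Prop} {g : ℕ → Prop}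
    (hg : ∀ k s, I k s → (s p .x = s p .y ↔ g k))
    (hc : ∀ k s, I k s → ¬ g k → Spec c s (I (k + 1)) True) {s : State minSig} (hs : I 0 s) :
    Spec (loop p c) s (fun s' => ∃ K, I K s' ∧ g K ∧ ∀ j < K, ¬ g j) (∃ K, g K) := by
  constructor
  · intro s' he
    have key : ∀ d, Exec d s s' → d = loop p c → ∀ k, I k s → (∀ j < k, ¬ g j) →
        ∃ K, I K s' ∧ g K ∧ ∀ j < K, ¬ g j := by
      clear he hs
      intro d he
      induction he with
      | loopExit h =>
        rintro ⟨⟩ k hk hj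
        exact ⟨k, hk, (hg k _ hk).1 h, hj⟩
      | loopStep h h₁ _ _ ih =>
        rintro ⟨⟩ k hk hj
        have hk' : ¬ g k := mt (hg k _ hk).2 h
        refine ih rfl (k + 1) ((hc k _ hk hk').1 _ h₁) fun j hjk => ?_
        rcases Nat.lt_succ_iff_lt_or_eq.1 hjk with hjk | rfl
        exacts [hj j hjk, hk']
      | _ => exact fun h => Cmd.noConfusion h
    exact key _ he rfl 0 hs (by simp)
  · rintro ⟨K, hK⟩
    have key : ∀ d k s, I k s → k + d = K → ∃ s', Exec (loop p c) s s' := by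
      intro d
      induction d with
      | zero =>
        rintro k s hk rfl
        exact ⟨s, .loopExit ((hg _ s hk).2 hK)⟩
      | succ d ih =>
        intro k s hk hd
        -- `K` need not be the least index satisfying `g`, so the loop may exit before reaching it.
        by_cases hgk : g k
        · exact ⟨s, .loopExit ((hg _ s hk).2 hgk)⟩
        · have h := hc k s hk hgk
          obtain ⟨s₁, h₁⟩ := h.2 trivial
          obtain ⟨s₂, h₂⟩ := ih (k + 1) s₁ (h.1 _ h₁) (by omega)
          exact ⟨s₂, .loopStep (mt (hg k s hk).1 hgk) h₁ h₂⟩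
    exact key K 0 s hs (Nat.zero_add K)

/-! ### Programs for the partial recursive functions. -/

/-- `c` computes `f` from the processes `ps` into the process `q`, and changes nothing else in the
processes below `m`. -/
def Computes {n : ℕ} (c : Cmd) (m : ℕ) (f : List.Vector ℕ n →. ℕ) (ps : Fin n → ℕ) (q : ℕ) :
    Prop :=
  ∀ (v : List.Vector ℕ n) (s : State minSig), (∀ i, s (ps i) .x = v.get i) →
    Spec c s (fun s' => ∃ r ∈ f v, ∀ j < m, s' j = s.update q .x r j) (f v).Dom

/-- Functions computed by structured programs, for all choices of processes. -/
def Computable {n : ℕ} (f : List.Vector ℕ n →. ℕ) : Prop :=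
  ∀ (m : ℕ) (ps : Fin n → ℕ) (q : ℕ), (∀ i, ps i < m) → q < m → ∃ c : Cmd, Computes c m f ps q

/-- Evaluate `e` at `p` and store the value at `q`, using the process `t`. -/
def assign (p : ℕ) (e : MinExpr) (q t : ℕ) (hp : p ≠ t) (hq : t ≠ q) : Cmd :=
  (com p e t .x hp).seq (com t .this q .x hq)

/-- Self-communication is forbidden, so the detour through `t` is what allows `p = q`; the price is
that nothing is said about `t` afterwards. -/
theorem spec_assign {p : ℕ} {e : MinExpr} {q t : ℕ} (hp : p ≠ t) (hq : t ≠ q) {s : State minSig}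
    {T : Prop} :
    Spec (assign p e q t hp hq) s (fun s' => ∀ j ≠ t, s' j = s.update q .x (e.eval (s p)) j) T := by
  refine (spec_com hp (Q := fun s₁ => s₁ = s.update t .x (e.eval (s p))) rfl).seq ?_
  rintro s₁ rfl
  refine spec_com hq fun j hj => ?_
  funext z
  simp [State.update, MinExpr.eval, hj]

theorem computable_zero : Computable (n := 0) (fun _ => Part.some 0) := by
  intro m ps q _ hq
  -- `m` is merely some sender different from `q`: the expression `zero` ignores its memory.
  refine ⟨com m .zero q .x (by omega), fun v s _ => spec_com _ ⟨0, Part.mem_some 0, ?_⟩⟩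
  exact fun j _ => rfl

theorem computable_succ : Computable (n := 1) (fun v => Part.some (Nat.succ v.head)) := by
  intro m ps q hps hq
  have := hps 0
  refine ⟨assign (ps 0) .succ q m (by omega) (by omega), fun v s hv => ?_⟩
  refine (spec_assign _ _).mono (fun s' h => ⟨_, Part.mem_some _, fun j hj => ?_⟩) id
  rw [h j (by omega)]
  simp [MinExpr.eval, hv 0]

theorem computable_get {n : ℕ} (i : Fin n) :
    Computable (n := n) (fun v => Part.some (v.get i)) := by
  intro m ps q hps hq
  have := hps i
  refine ⟨assign (ps i) .this q m (by omega) (by omega), fun v s hv => ?_⟩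
  refine (spec_assign _ _).mono (fun s' h => ⟨_, Part.mem_some _, fun j hj => ?_⟩) id
  rw [h j (by omega)]
  simp [MinExpr.eval, hv i]

/-- Several computable functions can be evaluated into consecutive processes. -/
theorem exists_spec_mOfFn {n : ℕ} {ps : Fin n → ℕ} {k : ℕ} (g : Fin k → List.Vector ℕ n →. ℕ)
    (hg : ∀ i, Computable (g i)) (b : ℕ) (hps : ∀ i, ps i < b) :
    ∃ c : Cmd, ∀ (v : List.Vector ℕ n) (s : State minSig), (∀ i, s (ps i) .x = v.get i) →
      Spec c s (fun s' => ∃ w ∈ List.Vector.mOfFn fun i => g i v,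
        (∀ j < b, s' j = s j) ∧ ∀ i : Fin k, s' (b + i) .x = w.get i)
        (List.Vector.mOfFn fun i => g i v).Dom := by
  induction k generalizing b with
  | zero =>
    refine ⟨skip, fun v s _ => spec_skip ⟨.nil, ?_, fun _ _ => rfl, fun i => i.elim0⟩⟩
    simp [List.Vector.mOfFn, Part.pure_eq_some]
  | succ k ih =>
    -- The first result goes to `b`; the remaining programs use the bound `b + 1` and therefore
    -- preserve it.
    obtain ⟨c₁, h₁⟩ := hg 0 (b + 1) ps b (fun i => (hps i).trans (Nat.lt_succ_self b))
      (Nat.lt_succ_self b)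
    obtain ⟨c₂, h₂⟩ := ih (fun i => g i.succ) (fun i => hg i.succ) (b + 1)
      (fun i => (hps i).trans (Nat.lt_succ_self b))
    refine ⟨c₁.seq c₂, fun v s hv => ?_⟩
    have hdom : (List.Vector.mOfFn fun i => g i v).Dom →
        (g 0 v).Dom ∧ (List.Vector.mOfFn fun i => g (Fin.succ i) v).Dom := by
      simp only [Part.dom_iff_mem, List.Vector.mOfFn, Part.bind_eq_bind, Part.mem_bind_iff]
      rintro ⟨_, a, ha, w, hw, -⟩
      exact ⟨⟨a, ha⟩, ⟨w, hw⟩⟩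
    refine ((h₁ v s hv).mono (fun _ => id) fun h => (hdom h).1).seq ?_
    rintro s₁ ⟨r, hr, hs₁⟩
    refine (h₂ v s₁ fun i => ?_).mono ?_ fun h => (hdom h).2
    · have := hps i
      rw [hs₁ _ (by omega), State.update_of_ne _ _ _ (by simp; omega), hv]
    · rintro s' ⟨w, hw, hs', hw'⟩
      refine ⟨r ::ᵥ w, ?_, fun j hj => ?_, fun i => ?_⟩
      · simp only [List.Vector.mOfFn, Part.bind_eq_bind, Part.mem_bind_iff, Part.pure_eq_some]
        exact ⟨r, hr, w, hw, Part.mem_some _⟩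
      · rw [hs' j (by omega), hs₁ j (by omega), State.update_of_ne _ _ _ (by simp; omega)]
      · refine Fin.cases ?_ (fun i => ?_) i
        · simp [hs' b, hs₁ b, State.update]
        · rw [List.Vector.get_cons_succ, ← hw' i, Fin.val_succ, Nat.add_assoc b 1,
            Nat.add_comm 1]

theorem Computable.comp {n k : ℕ} {f : List.Vector ℕ k →. ℕ} {g : Fin k → List.Vector ℕ n →. ℕ}
    (hf : Computable f) (hg : ∀ i, Computable (g i)) :
    Computable fun v => (List.Vector.mOfFn fun i => g i v) >>= f := by
  intro m ps q hps hq
  obtain ⟨c₁, h₁⟩ := exists_spec_mOfFn g hg m hps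
  obtain ⟨c₂, h₂⟩ := hf (m + k) (fun i => m + i) q (fun i => by omega) (by omega)
  refine ⟨c₁.seq c₂, fun v s hv => ?_⟩
  refine ((h₁ v s hv).mono (fun _ => id) fun h => ?_).seq ?_
  · rw [Part.dom_iff_mem] at h ⊢
    obtain ⟨_, h⟩ := h
    obtain ⟨w, hw, -⟩ := Part.mem_bind_iff.1 h
    exact ⟨w, hw⟩
  · rintro s₁ ⟨w, hw, hs₁, hw₁⟩
    refine (h₂ w s₁ hw₁).mono ?_ fun h => ?_
    · rintro s' ⟨r, hr, hs'⟩
      refine ⟨r, Part.mem_bind hw hr, fun j hj => ?_⟩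
      rw [hs' j (by omega)]
      funext z
      simp only [State.update]
      rw [hs₁ j hj]
    · obtain ⟨r, hr⟩ := Part.dom_iff_mem.1 h
      obtain ⟨w', hw', hr⟩ := Part.mem_bind_iff.1 hr
      obtain rfl := Part.mem_unique hw hw'
      exact Part.dom_iff_mem.2 ⟨r, hr⟩

theorem cons_inputs {n : ℕ} {s : State minSig} {p a : ℕ} {ps : Fin n → ℕ} {v : List.Vector ℕ n}
    (ha : s p .x = a) (hv : ∀ i, s (ps i) .x = v.get i) (i : Fin (n + 1)) :
    s ((Fin.cons p ps : Fin (n + 1) → ℕ) i) .x = (a ::ᵥ v).get i := by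
  refine Fin.cases ?_ (fun i => ?_) i
  · simpa using ha
  · simpa using hv i

theorem cons_lt {n p m : ℕ} {ps : Fin n → ℕ} (hp : p < m) (hps : ∀ i, ps i < m)
    (i : Fin (n + 1)) : (Fin.cons p ps : Fin (n + 1) → ℕ) i < m := by
  refine Fin.cases ?_ (fun i => ?_) i
  · simpa using hp
  · simpa using hps i

/-- Process `m` holds the counter in `x` and the recursion argument in `y`, `m + 1` accumulates the
current value and is overwritten in place, and `m + 2` is used for copying. The output `q` may be
one of the inputs, so it is written only after the loop. -/
theorem Computable.prec {n : ℕ} {f : List.Vector ℕ n → ℕ} {g : List.Vector ℕ (n + 2) → ℕ}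
    (hf : Computable fun v => Part.some (f v)) (hg : Computable fun v => Part.some (g v)) :
    Computable fun v : List.Vector ℕ (n + 1) =>
      Part.some (v.head.rec (f v.tail) fun y IH => g (y ::ᵥ IH ::ᵥ v.tail)) := by
  intro m ps q hps hq
  have hps' : ∀ i, Fin.tail ps i < m + 2 := fun i => (hps i.succ).trans (by omega)
  have h0 := hps 0
  obtain ⟨cf, hcf⟩ := hf (m + 2) (Fin.tail ps) (m + 1) hps' (by omega)
  obtain ⟨cg, hcg⟩ := hg (m + 2) (Fin.cons m (Fin.cons (m + 1) (Fin.tail ps))) (m + 1)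
    (cons_lt (by omega) (cons_lt (by omega) hps')) (by omega)
  refine ⟨cf.seq ((com (ps 0) .this m .y (by omega)).seq ((com (m + 2) .zero m .x (by omega)).seq
    ((loop m (cg.seq (assign m .succ m (m + 2) (by omega) (by omega)))).seq
      (assign (m + 1) .this q (m + 2) (by omega) (by omega))))), fun v s hv => ?_⟩
  have hv' : ∀ s' : State minSig, (∀ j < m, s' j = s j) →
      ∀ i, s' (Fin.tail ps i) .x = v.tail.get i := by
    intro s' hs' i
    rw [Fin.tail, hs' _ (hps _), hv, List.Vector.get_tail_succ]
  set F : ℕ → ℕ := fun k => Nat.rec (f v.tail) (fun y IH => g (y ::ᵥ IH ::ᵥ v.tail)) k with hF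
  let I : ℕ → State minSig → Prop := fun k s' =>
    s' m .x = k ∧ s' m .y = v.head ∧ s' (m + 1) .x = F k ∧ ∀ j < m, s' j = s j
  refine ((hcf v.tail s (hv' s fun _ _ => rfl)).mono (fun _ => id) fun _ => trivial).seq ?_
  rintro s₁ ⟨r, hr, hs₁⟩
  obtain rfl := Part.mem_some_iff.1 hr
  refine (spec_com _ (Q := fun s' => s' = _) rfl).seq ?_
  rintro s₂ rfl
  have hI : I 0 ((s₁.update m .y (MinExpr.this.eval (s₁ (ps 0)))).update m .x 0) := by
    refine ⟨by simp [State.update], ?_, ?_, fun j hj => ?_⟩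
    · have : s (ps 0) .x = v.head := by rw [hv, List.Vector.get_zero]
      simp only [State.update, MinExpr.eval, hs₁ (ps 0) (by omega)]
      grind
    · simp [State.update, hs₁ (m + 1), hF]
    · rw [State.update_of_ne _ _ _ (by simp; omega), State.update_of_ne _ _ _ (by simp; omega),
        hs₁ j (by omega), State.update_of_ne _ _ _ (by simp; omega)]
  refine (spec_com _ (Q := I 0) hI).seq fun s₃ hs₃ => ?_
  have hloop := spec_loop (p := m) (c := cg.seq (assign m .succ m (m + 2) (by omega) (by omega)))
    (I := I) (g := fun k => k = v.head) (fun k s' h => by rw [h.1, h.2.1]) ?_ hs₃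
  · refine (hloop.mono (fun _ => id) fun _ => ⟨_, rfl⟩).seq ?_
    rintro s₄ ⟨_, hs₄, rfl, -⟩
    refine (spec_assign _ _).mono (fun s' hs' => ⟨F v.head, Part.mem_some _, fun j hj => ?_⟩) id
    rw [hs' j (by omega)]
    funext z
    simp only [State.update, MinExpr.eval]
    rw [hs₄.2.2.1, hs₄.2.2.2 j hj]
  · rintro k s' ⟨hk, hy, ha, hj⟩ -
    refine ((hcg _ s' (cons_inputs hk (cons_inputs ha (hv' s' hj)))).mono (fun _ => id)
      fun _ => trivial).seq ?_
    rintro s₅ ⟨r, hr, hs₅⟩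
    obtain rfl := Part.mem_some_iff.1 hr
    refine (spec_assign _ _).mono (fun s₆ hs₆ => ?_) id
    refine ⟨?_, ?_, ?_, fun j hjm => ?_⟩
    · simp [hs₆ m, hs₅ m, State.update, MinExpr.eval, hk]
    · simp [hs₆ m, hs₅ m, State.update, hy]
    · simp [hs₆ (m + 1), hs₅ (m + 1), State.update, hF]
    · rw [hs₆ j (by omega), State.update_of_ne _ _ _ (by simp; omega), hs₅ j (by omega),
        State.update_of_ne _ _ _ (by simp; omega), hj j hjm]

/-- Process `m` holds the candidate `k`, while `m + 1` holds `f (k ::ᵥ v)` in `x` and 0 in `y`, so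
that its guard tests for a zero of `f`. The guard is tested before the loop body, hence `f` is
evaluated once in advance. Each iteration terminates because `f` is total; only the search can
diverge. -/
theorem Computable.rfind {n : ℕ} {f : List.Vector ℕ (n + 1) → ℕ}
    (hf : Computable fun v => Part.some (f v)) :
    Computable fun v : List.Vector ℕ n =>
      Nat.rfind fun k => Part.some (decide (f (k ::ᵥ v) = 0)) := by
  intro m ps q hps hq
  have hps' : ∀ i, ps i < m + 2 := fun i => (hps i).trans (by omega)
  obtain ⟨c, hc⟩ := hf (m + 2) (Fin.cons m ps) (m + 1) (cons_lt (by omega) hps') (by omega)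
  refine ⟨(com (m + 2) .zero m .x (by omega)).seq ((com (m + 2) .zero (m + 1) .y (by omega)).seq
    (c.seq ((loop (m + 1) ((assign m .succ m (m + 2) (by omega) (by omega)).seq c)).seq
      (assign m .this q (m + 2) (by omega) (by omega))))), fun v s hv => ?_⟩
  let J : ℕ → State minSig → Prop := fun k s' =>
    s' m .x = k ∧ s' (m + 1) .y = 0 ∧ ∀ j < m, s' j = s j
  let I : ℕ → State minSig → Prop := fun k s' => J k s' ∧ s' (m + 1) .x = f (k ::ᵥ v)
  have hJI : ∀ (T : Prop) k s', J k s' → Spec c s' (I k) T := by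
    rintro T k s' ⟨hk, hy, hj⟩
    refine (hc (k ::ᵥ v) s' (cons_inputs hk fun i => by rw [hj _ (hps i), hv])).mono ?_
      fun _ => trivial
    rintro s₁ ⟨r, hr, hs₁⟩
    obtain rfl := Part.mem_some_iff.1 hr
    refine ⟨⟨?_, ?_, fun j hjm => ?_⟩, ?_⟩
    · simp [hs₁ m, State.update, hk]
    · simp [hs₁ (m + 1), State.update, hy]
    · rw [hs₁ j (by omega), State.update_of_ne _ _ _ (by simp; omega), hj j hjm]
    · simp [hs₁ (m + 1), State.update]
  refine (spec_com _ (Q := fun s' => s' = _) rfl).seq ?_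
  rintro s₁ rfl
  have hJ : J 0 ((s.update m .x 0).update (m + 1) .y 0) := by
    refine ⟨by simp [State.update], by simp [State.update], fun j hj => ?_⟩
    rw [State.update_of_ne _ _ _ (by simp; omega), State.update_of_ne _ _ _ (by simp; omega)]
  refine (spec_com _ (Q := J 0) hJ).seq fun s₂ hs₂ => (hJI _ 0 s₂ hs₂).seq fun s₃ hs₃ => ?_
  have hloop := spec_loop (p := m + 1)
    (c := (assign m .succ m (m + 2) (by omega) (by omega)).seq c)
    (I := I) (g := fun k => f (k ::ᵥ v) = 0) (fun k s' h => by rw [h.2, h.1.2.1]) ?_ hs₃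
  · refine (hloop.mono (fun _ => id) fun h => ?_).seq ?_
    · obtain ⟨K, hK, -⟩ := Nat.rfind_dom.1 h
      exact ⟨K, by simpa using hK⟩
    · rintro s₄ ⟨K, hs₄, hK, hlt⟩
      refine (spec_assign _ _).mono (fun s' hs' => ⟨K, ?_, fun j hj => ?_⟩) id
      -- The loop rule yields a zero with no smaller one, which is exactly membership in
      -- `Nat.rfind`.
      · refine Nat.mem_rfind.2 ⟨by simp [hK], fun {j} hj => ?_⟩
        simpa using hlt j hj
      · rw [hs' j (by omega)]
        funext z
        simp only [State.update, MinExpr.eval]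
        rw [hs₄.1.1, hs₄.1.2.2 j hj]
  · rintro k s' ⟨⟨hk, hy, hj⟩, -⟩ -
    refine ((spec_assign _ _).mono (Q' := J (k + 1)) (fun s₅ hs₅ => ?_) id).seq
      fun s₅ hs₅ => hJI _ _ s₅ hs₅
    refine ⟨?_, ?_, fun j hjm => ?_⟩
    · simp [hs₅ m, State.update, MinExpr.eval, hk]
    · simp [hs₅ (m + 1), State.update, hy]
    · rw [hs₅ j (by omega), State.update_of_ne _ _ _ (by simp; omega), hj j hjm]

theorem computable_of_primrec' {n : ℕ} {f : List.Vector ℕ n → ℕ} (hf : Nat.Primrec' f) :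
    Computable fun v => Part.some (f v) := by
  induction hf with
  | zero => exact computable_zero
  | succ => exact computable_succ
  | get i => exact computable_get i
  | comp g _ _ ihf ihg =>
    have h := ihf.comp ihg
    -- For total components the tuple `mOfFn` is always defined, and the bind reduces to ordinary
    -- composition.
    simpa using h
  | prec _ _ ihf ihg => exact ihf.prec ihg

theorem computable_of_partrec' {n : ℕ} {f : List.Vector ℕ n →. ℕ} (hf : Nat.Partrec' f) :
    Computable f := by
  induction hf with
  | prim h => exact computable_of_primrec' h
  | comp g _ _ ihf ihg => exact ihf.comp ihg
  | rfind _ ih => exact ih.rfind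

end Cmd

end CC

theorem mainTheorem3 (n : ℕ) (f : List.Vector ℕ n →. ℕ) (hf : Partrec f)
    (ps : Fin n → ℕ) (hps : Function.Injective ps) (q : ℕ) :
    ∃ P : CC.Program CC.minSig,
      P.WF ∧ P.main.initial ∧ (∃ Xs : List ℕ, P.usedProcedures Xs) ∧
        CC.Implements P f ps q := by
  obtain ⟨c, hc⟩ := CC.Cmd.computable_of_partrec' (Nat.Partrec'.part_iff.2 hf)
    -- Any number above all inputs and `q` would do as the start of the scratch space.
    (∑ i, ps i + q + 1) ps q
    (fun i => by
      have := Finset.single_le_sum (f := ps) (fun j _ => Nat.zero_le _) (Finset.mem_univ i)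
      omega) (by omega)
  refine ⟨c.toProgram, c.wf_toProgram, c.admissible_main.initial,
    ⟨_, c.usedProcedures_toProgram⟩, fun v s hs => ⟨fun r hr => ⟨?_, fun ts d h hd => ?_⟩,
    fun hdom ts d h hd => ?_⟩⟩
  · obtain ⟨s', hs'⟩ := (hc v s hs).2 (Part.dom_iff_mem.2 ⟨r, hr⟩)
    exact hs'.steps
  · obtain ⟨r', hr', h'⟩ := (hc v s hs).1 _ (CC.Cmd.exec_of_steps h hd)
    rw [h' q (by omega), Part.mem_unique hr hr']
    simp [CC.State.update]
  · obtain ⟨r, hr, -⟩ := (hc v s hs).1 _ (CC.Cmd.exec_of_steps h hd)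
    exact hdom (Part.dom_iff_mem.2 ⟨r, hr⟩)
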